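/- Consider a stochastic bandit with $k$ actions, horizon $n\ge k$ and mean reward vector $\mu\in[0,1]^k$. In each round $t=1,\dots,n$ an action $A_t\in\{1,\dots,k\}$ is played and a reward $Y_t\in[0,1]$ is observed, whose conditional distribution given the past $(A_s,Y_s)_{s<t}$ and $A_t$ has mean $\mu_{A_t}$. Softmax policy gradient with learning rate $\eta>0$ starts from $\theta_1=0\in\mathbb R^k$; in round $t$, given the past, it samples $A_t$ from $\pi_t$, where $\pi_{t,a}=\exp(\theta_{t,a})/\sum_{b}\exp(\theta_{t,b})$, and then sets $\theta_{t+1,a}=\theta_{t,a}+\eta(\mathbf 1_{A_t=a}-\pi_{t,a})Y_t$ for every action $a$. Let $\Delta_a=\max_b\mu_b-\mu_a$, assume that at least one action is suboptimal ($\Delta_a>0$ for some $a$; several actions may be optimal), and let $\Delta_{\min}=\min\{\Delta_a:\Delta_a>0\}$, $\Delta_{\max}=\max_a\Delta_a$ and $\mathrm{Reg}_n=\sum_{t=1}^n\Delta_{A_t}$. **Theorem.** There is a universal constant $C>0$ such that, for all $k$, $n$, $\mu$, $\eta$ and reward distributions as above, if $$\eta\le\frac{\Delta_{\min}^2}{120\,\Delta_{\max}\log(nk)},$$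 then $$\mathbb E[\mathrm{Reg}_n]\le C\,\frac{k\log(n)\log(k)}{\eta}.$$ -/

import Mathlib

open MeasureTheory

noncomputable section

namespace Bandit

/-- The softmax policy: `softmax θ a` is proportional to `exp (θ a)`. -/
def softmax {k : ℕ} (θ : Fin k → ℝ) (a : Fin k) : ℝ :=
  Real.exp (θ a) / ∑ b, Real.exp (θ b)

/-- The logits of softmax policy gradient with learning rate `η`, as a function of the played
actions `A` and the observed rewards `Y`. Rounds are numbered `0, 1, 2, …`; `logits η A Y t` is
the parameter vector used to choose the action of round `t`. -/
def logits {k : ℕ} {Ω : Type*} (η : ℝ) (A : ℕ → Ω → Fin k) (Y : ℕ → Ω → ℝ) :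
    ℕ → Ω → Fin k → ℝ
  | 0 => fun _ _ => 0
  | t + 1 => fun ω a =>
      logits η A Y t ω a
        + η * ((if A t ω = a then 1 else 0) - softmax (logits η A Y t ω) a) * Y t ω

/-- The σ-algebra generated by the actions and rewards of the rounds before round `t`. -/
@[reducible]
def history {k : ℕ} {Ω : Type*} (A : ℕ → Ω → Fin k) (Y : ℕ → Ω → ℝ) (t : ℕ) :
    MeasurableSpace Ω :=
  ⨆ s : ℕ, ⨆ _ : s < t,
    MeasurableSpace.comap (A s) inferInstance ⊔ MeasurableSpace.comap (Y s) inferInstance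

/-- `(A t, Y t)`, `t < n`, are the actions and rewards produced in `n` rounds by softmax policy
gradient with learning rate `η` on a stochastic bandit with mean reward vector `μ` and rewards
in `[0, 1]`. Rewards may have any conditional distribution on `[0, 1]` with mean `μ (A t)`; this
includes the case where each arm has a fixed reward distribution. -/
structure IsPolicyGradientRun {k : ℕ} {Ω : Type*} [MeasurableSpace Ω] (P : Measure Ω)
    (μ : Fin k → ℝ) (η : ℝ) (n : ℕ) (A : ℕ → Ω → Fin k) (Y : ℕ → Ω → ℝ) : Prop where
  measurable_action : ∀ t < n, Measurable (A t)
  measurable_reward : ∀ t < n, Measurable (Y t)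
  reward_mem : ∀ t < n, ∀ᵐ ω ∂P, Y t ω ∈ Set.Icc (0 : ℝ) 1
  /-- Given the past, the action of round `t` is sampled from the softmax policy. -/
  action_law : ∀ t < n, ∀ a : Fin k,
    P[fun ω => if A t ω = a then (1 : ℝ) else 0 | history A Y t]
      =ᵐ[P] fun ω => softmax (logits η A Y t ω) a
  /-- Given the past and the action of round `t`, the reward has mean `μ (A t)`. -/
  reward_mean : ∀ t < n,
    P[Y t | history A Y t ⊔ MeasurableSpace.comap (A t) inferInstance]
      =ᵐ[P] fun ω => μ (A t ω)

/-- The suboptimality gap of an action. -/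
def gap {k : ℕ} (μ : Fin k → ℝ) (a : Fin k) : ℝ := (⨆ b, μ b) - μ a

/-- The smallest positive suboptimality gap (used when a suboptimal action exists). -/
def gapMin {k : ℕ} (μ : Fin k → ℝ) : ℝ := ⨅ a : {a : Fin k // 0 < gap μ a}, gap μ a

/-- The largest suboptimality gap. -/
def gapMax {k : ℕ} (μ : Fin k → ℝ) : ℝ := ⨆ a, gap μ a

/-- The (random) regret over `n` rounds. -/
def regret {k : ℕ} {Ω : Type*} (μ : Fin k → ℝ) (n : ℕ) (A : ℕ → Ω → Fin k) (ω : Ω) : ℝ :=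
  ∑ t ∈ Finset.range n, gap μ (A t ω)

end Bandit

end

noncomputable section

namespace Bandit

variable {k : ℕ}

/-! Two potential arguments are combined. Write `π` for the softmax probabilities, `d` for the mean
gap of the current policy, `q` for the average probability of an optimal action.

Ordering. For `a` optimal and `b` suboptimal, the expected increment of `θ b - θ a` is `η (π_b (d -
gap b) - π_a d)`. While `0 ≤ θ b - θ a ≤ ε`, `π_a` is at least `(1 - ε) π_b`, so the increment is at
most `-η π_b (gap b - ε gapMax)`; the step has second moment of order `η² π_b`. A small learning
rate therefore makes `exp (l (θ b - θ a))` a supermartingale inside this window. Truncated at both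
ends, it grows in mean by at most 2 per round (`integral_pairPotential_le`). Markov's inequality and
a union bound over pairs then give `IsOrdered` except with probability of order `1/n` per round.

Decay. On ordered logits `π_b ≤ 2 q` for suboptimal `b`, hence `q ≥ 1/(2k)`, and `gapMass` has drift
at most `-(η/3) q d` times itself (`IsOrdered.sum_massDrift_le`). So the logarithm of `gapMass + δ`
falls in mean by about `η d / (6 k)` per round; a bad round raises it by at most `2 η`. With `δ =
1/n` this logarithm starts below `log (k + 1)` and never falls below `-log n`. Telescoping bounds
the sum of the expected mean gaps, which is the expected regret, by a multiple of `k log n / η`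
(`integral_regret_le`). The factor `log k` of the theorem is needed only through its lower bound
`1/2`. -/

theorem softmax_nonneg (θ : Fin k → ℝ) (a : Fin k) : 0 ≤ softmax θ a := by
  unfold softmax; positivity

theorem sum_exp_pos (θ : Fin k → ℝ) (a : Fin k) : 0 < ∑ b, Real.exp (θ b) :=
  Finset.sum_pos (fun _ _ => Real.exp_pos _) ⟨a, Finset.mem_univ a⟩

theorem sum_softmax (θ : Fin k → ℝ) (a : Fin k) : ∑ b, softmax θ b = 1 := by
  unfold softmax
  rw [← Finset.sum_div, div_self (sum_exp_pos θ a).ne']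

theorem softmax_le_one (θ : Fin k → ℝ) (a : Fin k) : softmax θ a ≤ 1 := by
  rw [← sum_softmax θ a]
  exact Finset.single_le_sum (fun b _ => softmax_nonneg θ b) (Finset.mem_univ a)

theorem softmax_eq_exp_sub_mul (θ : Fin k → ℝ) (a b : Fin k) :
    softmax θ b = Real.exp (θ b - θ a) * softmax θ a := by
  unfold softmax
  rw [Real.exp_sub]
  field_simp

theorem continuous_softmax (a : Fin k) : Continuous fun θ : Fin k → ℝ => softmax θ a := by
  unfold softmax
  refine Continuous.div (by fun_prop) (by fun_prop) fun θ => (sum_exp_pos θ a).ne'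

/-! ### Suboptimality gaps and the mean gap of a policy -/

section Gap

variable (μ : Fin k → ℝ)

theorem le_iSup_mean (a : Fin k) : μ a ≤ ⨆ b, μ b :=
  le_ciSup (Set.finite_range μ).bddAbove a

theorem gap_nonneg (a : Fin k) : 0 ≤ gap μ a := sub_nonneg.2 (le_iSup_mean μ a)

theorem exists_gap_eq_zero (a₀ : Fin k) : ∃ a, gap μ a = 0 := by
  have : Nonempty (Fin k) := ⟨a₀⟩
  obtain ⟨a, ha⟩ := exists_eq_ciSup_of_finite (f := μ)
  exact ⟨a, by rw [gap, ha, sub_self]⟩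

theorem gap_le_gapMax (a : Fin k) : gap μ a ≤ gapMax μ :=
  le_ciSup (Set.finite_range (gap μ)).bddAbove a

theorem gapMin_le_gap {a : Fin k} (ha : 0 < gap μ a) : gapMin μ ≤ gap μ a :=
  ciInf_le (f := fun a : {a : Fin k // 0 < gap μ a} => gap μ a)
    (Set.finite_range _).bddBelow ⟨a, ha⟩

theorem gapMin_pos (h : ∃ a, 0 < gap μ a) : 0 < gapMin μ := by
  obtain ⟨a, ha⟩ := h
  have : Nonempty {a : Fin k // 0 < gap μ a} := ⟨⟨a, ha⟩⟩
  obtain ⟨b, hb⟩ := exists_eq_ciInf_of_finite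
    (f := fun a : {a : Fin k // 0 < gap μ a} => gap μ a)
  rw [gapMin, ← hb]
  exact b.2

theorem gap_le_one (hμ : ∀ a, μ a ∈ Set.Icc (0 : ℝ) 1) (a : Fin k) : gap μ a ≤ 1 := by
  have : Nonempty (Fin k) := ⟨a⟩
  have h1 : ⨆ b, μ b ≤ 1 := ciSup_le fun b => (hμ b).2
  have h2 := (hμ a).1
  rw [gap]; linarith

theorem gapMax_le_one (hμ : ∀ a, μ a ∈ Set.Icc (0 : ℝ) 1) (a : Fin k) : gapMax μ ≤ 1 := by
  have : Nonempty (Fin k) := ⟨a⟩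
  exact ciSup_le fun b => gap_le_one μ hμ b

/-- The conditional expected regret of a round played with logits `θ`. -/
def meanGap (θ : Fin k → ℝ) : ℝ := ∑ a, softmax θ a * gap μ a

theorem meanGap_nonneg (θ : Fin k → ℝ) : 0 ≤ meanGap μ θ :=
  Finset.sum_nonneg fun a _ => mul_nonneg (softmax_nonneg θ a) (gap_nonneg μ a)

theorem meanGap_le_gapMax (θ : Fin k → ℝ) (a₀ : Fin k) : meanGap μ θ ≤ gapMax μ := by
  calc meanGap μ θ ≤ ∑ a, softmax θ a * gapMax μ :=
        Finset.sum_le_sum fun a _ =>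
          mul_le_mul_of_nonneg_left (gap_le_gapMax μ a) (softmax_nonneg θ a)
    _ = gapMax μ := by rw [← Finset.sum_mul, sum_softmax θ a₀, one_mul]

theorem continuous_meanGap : Continuous (meanGap μ) := by
  unfold meanGap
  exact continuous_finsetSum _ fun a _ => (continuous_softmax a).mul continuous_const

theorem sum_softmax_mul_mean (θ : Fin k → ℝ) (a₀ : Fin k) :
    ∑ a, softmax θ a * μ a = (⨆ b, μ b) - meanGap μ θ := by
  have : ∀ a, softmax θ a * μ a = softmax θ a * (⨆ b, μ b) - softmax θ a * gap μ a := by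
    intro a; rw [gap]; ring
  simp_rw [this]
  rw [Finset.sum_sub_distrib, ← Finset.sum_mul, sum_softmax θ a₀, one_mul, meanGap]

/-- The expected reward-weighted centred indicator of the action `b`. -/
theorem sum_softmax_mul_mean_mul_centred (θ : Fin k → ℝ) (b : Fin k) :
    ∑ a, softmax θ a * μ a * ((if a = b then 1 else 0) - softmax θ b)
      = softmax θ b * (meanGap μ θ - gap μ b) := by
  simp_rw [mul_sub]
  rw [Finset.sum_sub_distrib, ← Finset.sum_mul, sum_softmax_mul_mean μ θ b]
  simp only [mul_ite, mul_one, mul_zero, Finset.sum_ite_eq', Finset.mem_univ, if_true]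
  rw [gap]; ring

end Gap

/-- One step of softmax policy gradient, with action `a` and reward `y`. -/
def gradStep (η : ℝ) (θ : Fin k → ℝ) (a : Fin k) (y : ℝ) : Fin k → ℝ :=
  fun c => θ c + η * ((if a = c then 1 else 0) - softmax θ c) * y

theorem abs_centred_le_one (θ : Fin k → ℝ) (a c : Fin k) :
    |(if a = c then 1 else 0) - softmax θ c| ≤ 1 := by
  have h0 := softmax_nonneg θ c
  have h1 := softmax_le_one θ c
  rw [abs_le]
  split_ifs <;> constructor <;> linarith

theorem exp_le_one_add_add_sq {z : ℝ} (hz : |z| ≤ 1) : Real.exp z ≤ 1 + z + z ^ 2 := by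
  have := (abs_le.1 (Real.abs_exp_sub_one_sub_id_le hz)).2
  linarith

/-- For `0 ≤ y ≤ 1` the second order bound on the exponential is linear in `y`. -/
theorem exp_mul_le_linear {z y : ℝ} (hz : |z| ≤ 1) (hy : y ∈ Set.Icc (0 : ℝ) 1) :
    Real.exp (z * y) ≤ 1 + y * (z + z ^ 2) := by
  have hzy : |z * y| ≤ 1 := by
    rw [abs_mul, abs_of_nonneg hy.1]
    exact mul_le_one₀ hz hy.1 hy.2
  -- Only the conditional mean of the reward is known, so the quadratic term `z² y²` is weakened to
  -- `z² y`.
  refine (exp_le_one_add_add_sq hzy).trans ?_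
  have : y * y ≤ y * 1 := mul_le_mul_of_nonneg_left hy.2 hy.1
  nlinarith [sq_nonneg z]

/-! ### One optimal against one suboptimal action: the truncated exponential -/

section Pair

variable (μ : Fin k → ℝ)

/-- The coefficient of the reward in the change of `θ b - θ a`. -/
def pairCoef (θ : Fin k → ℝ) (a b c : Fin k) : ℝ :=
  ((if c = b then 1 else 0) - softmax θ b) - ((if c = a then 1 else 0) - softmax θ a)

theorem gradStep_sub (η : ℝ) (θ : Fin k → ℝ) (a b c : Fin k) (y : ℝ) :
    gradStep η θ c y b - gradStep η θ c y a = θ b - θ a + η * pairCoef θ a b c * y := by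
  simp only [gradStep, pairCoef]; ring

theorem abs_pairCoef_le (θ : Fin k → ℝ) (a b c : Fin k) : |pairCoef θ a b c| ≤ 2 := by
  have h1 := abs_le.1 (abs_centred_le_one θ c b)
  have h2 := abs_le.1 (abs_centred_le_one θ c a)
  rw [pairCoef, abs_le]
  constructor <;> linarith [h1.1, h1.2, h2.1, h2.2]

theorem sum_softmax_mul_mean_mul_pairCoef (θ : Fin k → ℝ) (a b : Fin k) :
    ∑ c, softmax θ c * μ c * pairCoef θ a b c
      = softmax θ b * (meanGap μ θ - gap μ b) - softmax θ a * (meanGap μ θ - gap μ a) := by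
  simp only [pairCoef, mul_sub (_ * _) (_ - _) (_ - _)]
  rw [Finset.sum_sub_distrib, sum_softmax_mul_mean_mul_centred, sum_softmax_mul_mean_mul_centred]

/-- Second moment of the step. It must be proportional to the two probabilities, not merely bounded,
because the negative drift that has to absorb it is itself proportional to `softmax θ b`. -/
theorem sum_softmax_mul_pairCoef_sq_le (θ : Fin k → ℝ) {a b : Fin k} (hab : a ≠ b) :
    ∑ c, softmax θ c * pairCoef θ a b c ^ 2 ≤ softmax θ a + softmax θ b := by
  have key : ∀ c, softmax θ c * pairCoef θ a b c ^ 2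
      = (if c = b then softmax θ c * (1 - 2 * (softmax θ b - softmax θ a)) else 0)
        + (if c = a then softmax θ c * (1 + 2 * (softmax θ b - softmax θ a)) else 0)
        + softmax θ c * (softmax θ b - softmax θ a) ^ 2 := by
    intro c
    unfold pairCoef
    by_cases hb : c = b
    · have ha : c ≠ a := fun h => hab (h.symm.trans hb)
      simp only [hb, if_true, if_neg hab.symm]; ring
    · by_cases ha : c = a
      · simp only [ha, if_true, if_neg hab]; ring
      · simp only [if_neg ha, if_neg hb]; ring
  simp_rw [key]
  rw [Finset.sum_add_distrib, Finset.sum_add_distrib, ← Finset.sum_mul, sum_softmax θ a]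
  simp only [Finset.sum_ite_eq', Finset.mem_univ, if_true]
  nlinarith [sq_nonneg (softmax θ b - softmax θ a)]

/-- The truncated exponential of the difference `θ b - θ a`. -/
def pairPotential (l ε : ℝ) (a b : Fin k) (θ : Fin k → ℝ) : ℝ :=
  min (max (Real.exp (l * (θ b - θ a))) 1) (Real.exp (l * ε))

/-- The coefficient of the reward in the bound on the change of `pairPotential`. -/
def pairPotentialCoef (η l ε : ℝ) (a b c : Fin k) (θ : Fin k → ℝ) : ℝ :=
  if 0 ≤ θ b - θ a ∧ θ b - θ a ≤ ε then
    Real.exp (l * (θ b - θ a)) * (l * η * pairCoef θ a b c + (l * η * pairCoef θ a b c) ^ 2)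
  else 0

/-- The truncations remove the regions where the drift is not controlled: below 0 the noise is
governed by `softmax θ a`, which may dwarf `softmax θ b`; above `ε` the two probabilities are no
longer comparable. The price is the additive 2: one step multiplies the exponential by at most 3, so
from below the window it climbs from 1 to at most 3. -/
theorem pairPotential_gradStep_le {η l ε : ℝ} (hl : 0 ≤ l) (hε : 0 ≤ ε) (hη : 0 ≤ η)
    (hlη : l * η ≤ 1 / 2) (θ : Fin k → ℝ) (a b c : Fin k) {y : ℝ} (hy : y ∈ Set.Icc (0 : ℝ) 1) :
    pairPotential l ε a b (gradStep η θ c y) ≤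
      pairPotential l ε a b θ + 2 + y * pairPotentialCoef η l ε a b c θ := by
  have hlη0 : 0 ≤ l * η := mul_nonneg hl hη
  have hz : |l * η * pairCoef θ a b c| ≤ 1 := by
    rw [abs_mul, abs_of_nonneg hlη0]
    nlinarith [abs_pairCoef_le θ a b c, abs_nonneg (pairCoef θ a b c)]
  have hexp : Real.exp (l * (gradStep η θ c y b - gradStep η θ c y a))
      = Real.exp (l * (θ b - θ a)) * Real.exp (l * η * pairCoef θ a b c * y) := by
    rw [gradStep_sub, ← Real.exp_add]; congr 1; ring
  have hone : 1 ≤ Real.exp (l * ε) := Real.one_le_exp (mul_nonneg hl hε)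
  by_cases h1 : θ b - θ a ≤ ε
  · by_cases h0 : 0 ≤ θ b - θ a
    · rw [pairPotentialCoef, if_pos ⟨h0, h1⟩]
      have hge : Real.exp (l * (θ b - θ a)) ≤ pairPotential l ε a b θ :=
        le_min (le_max_left _ _) (Real.exp_le_exp.2 (mul_le_mul_of_nonneg_left h1 hl))
      have hle : pairPotential l ε a b (gradStep η θ c y)
          ≤ Real.exp (l * (gradStep η θ c y b - gradStep η θ c y a)) + 1 :=
        (min_le_left _ _).trans (max_le (by linarith) (by
          linarith [Real.exp_pos (l * (gradStep η θ c y b - gradStep η θ c y a))]))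
      rw [hexp] at hle
      have := mul_le_mul_of_nonneg_left (exp_mul_le_linear hz hy)
        (Real.exp_pos (l * (θ b - θ a))).le
      nlinarith
    · rw [pairPotentialCoef, if_neg (fun h => h0 h.1)]
      have hge : 1 ≤ pairPotential l ε a b θ := le_min (le_max_right _ _) hone
      have hle : pairPotential l ε a b (gradStep η θ c y) ≤ 3 := by
        refine (min_le_left _ _).trans (max_le ?_ (by norm_num))
        rw [hexp]
        have e1 : Real.exp (l * (θ b - θ a)) ≤ 1 :=
          Real.exp_le_one_iff.2 (mul_nonpos_of_nonneg_of_nonpos hl (by linarith))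
        have e2 : Real.exp (l * η * pairCoef θ a b c * y) ≤ 3 := by
          refine (exp_mul_le_linear hz hy).trans ?_
          have := abs_le.1 hz
          nlinarith [hy.1, hy.2, sq_nonneg (l * η * pairCoef θ a b c)]
        nlinarith [Real.exp_pos (l * (θ b - θ a)),
          Real.exp_pos (l * η * pairCoef θ a b c * y)]
      linarith
  · rw [pairPotentialCoef, if_neg (fun h => h1 h.2)]
    have h2 : Real.exp (l * ε) ≤ pairPotential l ε a b θ :=
      le_min (le_max_of_le_left (Real.exp_le_exp.2
        (mul_le_mul_of_nonneg_left (not_le.1 h1).le hl))) le_rfl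
    have h3 : pairPotential l ε a b (gradStep η θ c y) ≤ Real.exp (l * ε) := min_le_right _ _
    linarith

/-- Inside the window `softmax θ a` lies between `(1 - ε) softmax θ b` and `softmax θ b`. After
division by `softmax θ b`, the term `ε * gapMax μ` pays for the imbalance of the two probabilities
and `2 * (l * η)` for the second order. -/
theorem sum_pairPotentialCoef_nonpos {η l ε : ℝ} (hμ : ∀ a, μ a ∈ Set.Icc (0 : ℝ) 1)
    (hl : 0 ≤ l) (hη : 0 ≤ η) {a b : Fin k} (ha : gap μ a = 0)
    (hb : 0 < gap μ b) (hεb : ε * gapMax μ + 2 * (l * η) ≤ gap μ b) (θ : Fin k → ℝ) :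
    ∑ c, softmax θ c * μ c * pairPotentialCoef η l ε a b c θ ≤ 0 := by
  have hlη0 : 0 ≤ l * η := mul_nonneg hl hη
  have hab : a ≠ b := fun h => by rw [h] at ha; linarith
  by_cases h : 0 ≤ θ b - θ a ∧ θ b - θ a ≤ ε
  swap
  · simp only [pairPotentialCoef, if_neg h, mul_zero, Finset.sum_const_zero, le_refl]
  simp only [pairPotentialCoef, if_pos h]
  have e1 : ∀ c, softmax θ c * μ c * (Real.exp (l * (θ b - θ a)) *
        (l * η * pairCoef θ a b c + (l * η * pairCoef θ a b c) ^ 2))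
      ≤ Real.exp (l * (θ b - θ a)) * (l * η * (softmax θ c * μ c * pairCoef θ a b c
        + l * η * (softmax θ c * pairCoef θ a b c ^ 2))) := by
    intro c
    have h1 : softmax θ c * μ c * pairCoef θ a b c ^ 2 ≤ softmax θ c * pairCoef θ a b c ^ 2 :=
      mul_le_mul_of_nonneg_right
        (mul_le_of_le_one_right (softmax_nonneg θ c) (hμ c).2) (sq_nonneg _)
    have h2 := mul_le_mul_of_nonneg_left h1 (mul_nonneg hlη0 hlη0)
    have h3 := mul_le_mul_of_nonneg_left h2 (Real.exp_pos (l * (θ b - θ a))).le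
    nlinarith
  refine (Finset.sum_le_sum fun c _ => e1 c).trans ?_
  rw [← Finset.mul_sum, ← Finset.mul_sum, Finset.sum_add_distrib, ← Finset.mul_sum,
    sum_softmax_mul_mean_mul_pairCoef, ha, sub_zero]
  refine mul_nonpos_of_nonneg_of_nonpos (Real.exp_pos _).le
    (mul_nonpos_of_nonneg_of_nonpos hlη0 ?_)
  have h2 := mul_le_mul_of_nonneg_left (sum_softmax_mul_pairCoef_sq_le θ hab) hlη0
  have hπ := softmax_eq_exp_sub_mul θ b a
  have hexp : 1 - ε ≤ Real.exp (θ a - θ b) := by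
    linarith [Real.add_one_le_exp (θ a - θ b), h.2]
  have hexp1 : Real.exp (θ a - θ b) ≤ 1 := Real.exp_le_one_iff.2 (by linarith [h.1])
  have hpb := softmax_nonneg θ b
  have hd0 := meanGap_nonneg μ θ
  have hd1 := meanGap_le_gapMax μ θ a
  have hε : 0 ≤ ε := h.1.trans h.2
  -- everything is a multiple of `softmax θ b`
  have : softmax θ b * (meanGap μ θ - gap μ b) - softmax θ a * meanGap μ θ
      + l * η * (softmax θ a + softmax θ b) ≤ 0 := by
    rw [hπ]
    have h4 : (1 - Real.exp (θ a - θ b)) * meanGap μ θ ≤ ε * gapMax μ :=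
      mul_le_mul (by linarith) hd1 hd0 hε
    have h5 : l * η * Real.exp (θ a - θ b) ≤ l * η := mul_le_of_le_one_right hlη0 hexp1
    have h6 : (meanGap μ θ - gap μ b) - Real.exp (θ a - θ b) * meanGap μ θ
      + l * η * (Real.exp (θ a - θ b) + 1) ≤ 0 := by linarith
    have := mul_nonpos_of_nonneg_of_nonpos hpb h6
    linarith
  linarith

end Pair

/-! ### The gap mass relative to the optimal actions, and its drift -/

section Mass

variable (μ : Fin k → ℝ)

/-- The set of optimal actions. -/
def optSet : Finset (Fin k) := Finset.univ.filter fun a => gap μ a = 0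

theorem mem_optSet {a : Fin k} : a ∈ optSet μ ↔ gap μ a = 0 := by simp [optSet]

theorem card_optSet_pos (a₀ : Fin k) : (0 : ℝ) < (optSet μ).card := by
  obtain ⟨a, ha⟩ := exists_gap_eq_zero μ a₀
  exact_mod_cast Finset.card_pos.2 ⟨a, (mem_optSet μ).2 ha⟩

/-- The average logit of the optimal actions. -/
def optMean (θ : Fin k → ℝ) : ℝ := (∑ a ∈ optSet μ, θ a) / (optSet μ).card

/-- The average probability of the optimal actions. -/
def optProb (θ : Fin k → ℝ) : ℝ := (∑ a ∈ optSet μ, softmax θ a) / (optSet μ).card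

/-- The weight of an action relative to the optimal actions. -/
def relWeight (θ : Fin k → ℝ) (b : Fin k) : ℝ := Real.exp (θ b - optMean μ θ)

/-- The sum of the gaps, weighted relative to the optimal actions. -/
def gapMass (θ : Fin k → ℝ) : ℝ := ∑ b, gap μ b * relWeight μ θ b

/-- The coefficient of the reward in the change of `θ b - optMean μ θ`. -/
def massCoef (θ : Fin k → ℝ) (b c : Fin k) : ℝ :=
  ((if c = b then 1 else 0) - softmax θ b)
    - (∑ a ∈ optSet μ, ((if c = a then 1 else 0) - softmax θ a)) / (optSet μ).card

theorem gradStep_sub_optMean (η : ℝ) (θ : Fin k → ℝ) (b c : Fin k) (y : ℝ) :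
    gradStep η θ c y b - optMean μ (gradStep η θ c y)
      = θ b - optMean μ θ + η * massCoef μ θ b c * y := by
  simp only [gradStep, massCoef, optMean]
  rw [Finset.sum_add_distrib, ← Finset.sum_mul, ← Finset.mul_sum]
  ring

theorem relWeight_gradStep (η : ℝ) (θ : Fin k → ℝ) (b c : Fin k) (y : ℝ) :
    relWeight μ (gradStep η θ c y) b
      = relWeight μ θ b * Real.exp (η * massCoef μ θ b c * y) := by
  rw [relWeight, relWeight, gradStep_sub_optMean, Real.exp_add]

theorem abs_massCoef_le (θ : Fin k → ℝ) (b c : Fin k) : |massCoef μ θ b c| ≤ 2 := by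
  have h1 := abs_centred_le_one θ c b
  have hm := card_optSet_pos μ b
  have h2 : |(∑ a ∈ optSet μ, ((if c = a then 1 else 0) - softmax θ a)) / (optSet μ).card|
      ≤ 1 := by
    rw [abs_div, abs_of_pos hm, div_le_one hm]
    refine (Finset.abs_sum_le_sum_abs _ _).trans ?_
    refine (Finset.sum_le_sum fun a _ => abs_centred_le_one θ c a).trans ?_
    simp
  refine (abs_sub _ _).trans ?_
  linarith

theorem gapMass_nonneg (θ : Fin k → ℝ) : 0 ≤ gapMass μ θ :=
  Finset.sum_nonneg fun b _ => mul_nonneg (gap_nonneg μ b) (Real.exp_pos _).le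

theorem continuous_gapMass : Continuous (gapMass μ) := by
  unfold gapMass relWeight optMean
  fun_prop

/-- Relative weights are softmax probabilities times a common factor, which is why `gapMass` factors
through `meanGap`. -/
theorem relWeight_eq (θ : Fin k → ℝ) (b : Fin k) :
    relWeight μ θ b = softmax θ b * ∑ c, relWeight μ θ c := by
  unfold relWeight softmax
  simp_rw [Real.exp_sub]
  rw [← Finset.sum_div]
  have := sum_exp_pos θ b
  field_simp

theorem gapMass_eq (θ : Fin k → ℝ) :
    gapMass μ θ = meanGap μ θ * ∑ c, relWeight μ θ c := by
  rw [gapMass, meanGap, Finset.sum_mul]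
  refine Finset.sum_congr rfl fun b _ => ?_
  rw [relWeight_eq]; ring

theorem one_le_sum_relWeight (θ : Fin k → ℝ) (a₀ : Fin k) : 1 ≤ ∑ c, relWeight μ θ c := by
  have hm := card_optSet_pos μ a₀
  have hne : (optSet μ).Nonempty := Finset.card_pos.1 (by exact_mod_cast hm)
  -- Some optimal logit is at least the average optimal logit, so its weight alone is at least 1.
  obtain ⟨a, -, ha⟩ := Finset.exists_le_of_sum_le (s := optSet μ)
    (f := fun _ => optMean μ θ) (g := θ) hne (by
      rw [Finset.sum_const, nsmul_eq_mul, optMean, mul_div_cancel₀ _ hm.ne'])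
  have h1 : 1 ≤ relWeight μ θ a := Real.one_le_exp (by linarith)
  exact h1.trans (Finset.single_le_sum (f := relWeight μ θ)
    (fun c _ => (Real.exp_pos _).le) (Finset.mem_univ a))

theorem meanGap_le_gapMass (θ : Fin k → ℝ) (a₀ : Fin k) : meanGap μ θ ≤ gapMass μ θ := by
  rw [gapMass_eq]
  exact le_mul_of_one_le_right (meanGap_nonneg μ θ) (one_le_sum_relWeight μ θ a₀)

theorem optProb_nonneg (θ : Fin k → ℝ) : 0 ≤ optProb μ θ :=
  div_nonneg (Finset.sum_nonneg fun a _ => softmax_nonneg θ a) (Nat.cast_nonneg _)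

theorem sum_softmax_mul_mean_mul_massCoef (θ : Fin k → ℝ) (b : Fin k) :
    ∑ c, softmax θ c * μ c * massCoef μ θ b c
      = softmax θ b * (meanGap μ θ - gap μ b) - optProb μ θ * meanGap μ θ := by
  simp only [massCoef, mul_sub (_ * _) (_ - _) (_ / _)]
  rw [Finset.sum_sub_distrib, sum_softmax_mul_mean_mul_centred]
  congr 1
  simp_rw [mul_div_assoc', Finset.mul_sum]
  rw [← Finset.sum_div, Finset.sum_comm, optProb, div_mul_eq_mul_div, Finset.sum_mul]
  congr 1
  refine Finset.sum_congr rfl fun a ha => ?_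
  rw [sum_softmax_mul_mean_mul_centred, (mem_optSet μ).1 ha, sub_zero]

/-- Variance of a Bernoulli variable, used for `s = {b}` and for the set of optimal actions. -/
theorem sum_softmax_mul_sub_indicator_sq (θ : Fin k → ℝ) (a₀ : Fin k) (s : Finset (Fin k)) :
    ∑ c, softmax θ c * ((if c ∈ s then 1 else 0) - ∑ a ∈ s, softmax θ a) ^ 2
      = (∑ a ∈ s, softmax θ a) * (1 - ∑ a ∈ s, softmax θ a) := by
  set p := ∑ a ∈ s, softmax θ a with hp
  have key : ∀ c, softmax θ c * ((if c ∈ s then 1 else 0) - p) ^ 2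
      = (if c ∈ s then softmax θ c else 0) * (1 - 2 * p) + softmax θ c * p ^ 2 := by
    intro c; split_ifs <;> ring
  simp_rw [key]
  rw [Finset.sum_add_distrib, ← Finset.sum_mul, ← Finset.sum_mul, sum_softmax θ a₀,
    Finset.sum_ite_mem, Finset.univ_inter, ← hp]
  ring

/-- The probability of the suboptimal actions is at most the mean gap over the least gap. -/
theorem gapMin_mul_one_sub_le (θ : Fin k → ℝ) (a₀ : Fin k) :
    gapMin μ * (1 - ∑ a ∈ optSet μ, softmax θ a) ≤ meanGap μ θ := by
  have h : 1 - ∑ a ∈ optSet μ, softmax θ a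
      = ∑ a, if gap μ a = 0 then 0 else softmax θ a := by
    rw [← sum_softmax θ a₀, optSet, Finset.sum_filter, ← Finset.sum_sub_distrib]
    refine Finset.sum_congr rfl fun a _ => ?_
    split_ifs <;> ring
  rw [h, Finset.mul_sum, meanGap]
  refine Finset.sum_le_sum fun a _ => ?_
  split_ifs with ha
  · rw [ha]; simp
  · rw [mul_comm]
    exact mul_le_mul_of_nonneg_left
      (gapMin_le_gap μ (lt_of_le_of_ne (gap_nonneg μ a) (Ne.symm ha))) (softmax_nonneg θ a)

/-- The factor `1 - ∑ softmax` over optimal actions is essential: it is at most `meanGap μ θ /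
gapMin μ` when the least gap is positive, so this part of the noise is dominated by the drift term
`optProb μ θ * meanGap μ θ`. -/
theorem sum_softmax_mul_massCoef_sq_le (θ : Fin k → ℝ) (b : Fin k) :
    ∑ c, softmax θ c * massCoef μ θ b c ^ 2
      ≤ 2 * softmax θ b + 2 * (optProb μ θ * (1 - ∑ a ∈ optSet μ, softmax θ a)) := by
  have hm := card_optSet_pos μ b
  have hm1 : (1 : ℝ) ≤ (optSet μ).card := by
    exact_mod_cast (by exact_mod_cast hm : 0 < (optSet μ).card)
  set m : ℝ := ((optSet μ).card : ℝ) with hmdef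
  set p := ∑ a ∈ optSet μ, softmax θ a with hp
  have hp0 : 0 ≤ p := Finset.sum_nonneg fun a _ => softmax_nonneg θ a
  have hp1 : p ≤ 1 := by
    rw [hp, ← sum_softmax θ b]
    exact Finset.sum_le_sum_of_subset_of_nonneg (Finset.subset_univ _)
      fun a _ _ => softmax_nonneg θ a
  have h1 := sum_softmax_mul_sub_indicator_sq θ b {b}
  have h2 := sum_softmax_mul_sub_indicator_sq θ b (optSet μ)
  rw [← hp] at h2
  simp only [Finset.mem_singleton, Finset.sum_singleton] at h1
  have key : ∀ c, softmax θ c * massCoef μ θ b c ^ 2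
      ≤ 2 * (softmax θ c * ((if c = b then 1 else 0) - softmax θ b) ^ 2)
        + 2 / m ^ 2 * (softmax θ c * ((if c ∈ optSet μ then 1 else 0) - p) ^ 2) := by
    intro c
    have e : ∑ a ∈ optSet μ, ((if c = a then 1 else 0) - softmax θ a)
        = (if c ∈ optSet μ then 1 else 0) - p := by
      rw [Finset.sum_sub_distrib, Finset.sum_ite_eq, hp]
    rw [massCoef, e, ← hmdef]
    have := add_sq_le (a := (if c = b then (1 : ℝ) else 0) - softmax θ b)
      (b := -(((if c ∈ optSet μ then (1 : ℝ) else 0) - p) / m))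
    have h3 := mul_le_mul_of_nonneg_left this (softmax_nonneg θ c)
    refine le_trans (le_of_eq ?_) (h3.trans (le_of_eq ?_))
    · ring
    · field_simp
  refine (Finset.sum_le_sum fun c _ => key c).trans ?_
  rw [Finset.sum_add_distrib, ← Finset.mul_sum, ← Finset.mul_sum, h1, h2]
  have e1 : softmax θ b * (1 - softmax θ b) ≤ softmax θ b :=
    mul_le_of_le_one_right (softmax_nonneg θ b) (by linarith [softmax_nonneg θ b])
  have e2 : 2 / m ^ 2 * (p * (1 - p)) ≤ 2 * (optProb μ θ * (1 - p)) := by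
    rw [optProb, ← hp, ← hmdef]
    have : 2 / m ^ 2 * (p * (1 - p)) = 2 * (p / m * (1 - p)) / m := by field_simp
    rw [this]
    exact div_le_self (mul_nonneg (by norm_num)
      (mul_nonneg (div_nonneg hp0 hm.le) (by linarith))) hm1
  linarith

/-- The change of `gapMass`, per unit of reward, when the action `c` is played. -/
def massDrift (η : ℝ) (c : Fin k) (θ : Fin k → ℝ) : ℝ :=
  ∑ b, gap μ b * relWeight μ θ b * (η * massCoef μ θ b c + (η * massCoef μ θ b c) ^ 2)

theorem abs_mul_massCoef_le {η : ℝ} (hη : 0 ≤ η) (θ : Fin k → ℝ) (b c : Fin k) :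
    |η * massCoef μ θ b c| ≤ 2 * η := by
  rw [abs_mul, abs_of_nonneg hη]
  nlinarith [abs_massCoef_le μ θ b c]

theorem gapMass_gradStep_le {η : ℝ} (hη : 0 ≤ η) (hη1 : η ≤ 1 / 2) (θ : Fin k → ℝ) (c : Fin k)
    {y : ℝ} (hy : y ∈ Set.Icc (0 : ℝ) 1) :
    gapMass μ (gradStep η θ c y) ≤ gapMass μ θ + y * massDrift μ η c θ := by
  rw [gapMass, gapMass, massDrift, Finset.mul_sum, ← Finset.sum_add_distrib]
  refine Finset.sum_le_sum fun b _ => ?_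
  rw [relWeight_gradStep, ← mul_assoc]
  have h := exp_mul_le_linear ((abs_mul_massCoef_le μ hη θ b c).trans (by linarith)) hy
  have h0 : 0 ≤ gap μ b * relWeight μ θ b := mul_nonneg (gap_nonneg μ b) (Real.exp_pos _).le
  nlinarith [mul_le_mul_of_nonneg_left h h0]

theorem gapMass_gradStep_le_exp {η : ℝ} (hη : 0 ≤ η) (θ : Fin k → ℝ) (c : Fin k)
    {y : ℝ} (hy : y ∈ Set.Icc (0 : ℝ) 1) :
    gapMass μ (gradStep η θ c y) ≤ gapMass μ θ * Real.exp (2 * η) := by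
  rw [gapMass, gapMass, Finset.sum_mul]
  refine Finset.sum_le_sum fun b _ => ?_
  rw [relWeight_gradStep, ← mul_assoc]
  refine mul_le_mul_of_nonneg_left (Real.exp_le_exp.2 ?_)
    (mul_nonneg (gap_nonneg μ b) (Real.exp_pos _).le)
  refine (le_abs_self _).trans ?_
  rw [abs_mul, abs_of_nonneg hy.1]
  exact (mul_le_of_le_one_right (abs_nonneg _) hy.2).trans (abs_mul_massCoef_le μ hη θ b c)

theorem abs_massDrift_le {η : ℝ} (hη : 0 ≤ η) (hη1 : η ≤ 1 / 2) (c : Fin k) (θ : Fin k → ℝ) :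
    |massDrift μ η c θ| ≤ 2 * gapMass μ θ := by
  rw [massDrift, gapMass, Finset.mul_sum]
  refine (Finset.abs_sum_le_sum_abs _ _).trans (Finset.sum_le_sum fun b _ => ?_)
  have h0 : 0 ≤ gap μ b * relWeight μ θ b := mul_nonneg (gap_nonneg μ b) (Real.exp_pos _).le
  have h1 := abs_le.1 ((abs_mul_massCoef_le μ hη θ b c).trans (by linarith : 2 * η ≤ 1))
  rw [abs_mul, abs_of_nonneg h0, mul_comm 2]
  refine mul_le_mul_of_nonneg_left ?_ h0
  rw [abs_le]
  constructor <;> nlinarith [h1.1, h1.2]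

/-- No suboptimal logit exceeds an optimal one by more than `ε`. -/
def IsOrdered (ε : ℝ) (θ : Fin k → ℝ) : Prop :=
  ∀ a b, gap μ a = 0 → 0 < gap μ b → θ b - θ a ≤ ε

theorem measurableSet_isOrdered (ε : ℝ) : MeasurableSet {θ : Fin k → ℝ | IsOrdered μ ε θ} := by
  unfold IsOrdered
  simp only [Set.ofPred_forall]
  refine MeasurableSet.iInter fun a => MeasurableSet.iInter fun b =>
    MeasurableSet.iInter fun _ => MeasurableSet.iInter fun _ => ?_
  exact measurableSet_le (by fun_prop) (by fun_prop)

variable {μ}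

theorem IsOrdered.softmax_le {ε : ℝ} (hε : ε ≤ 1 / 2) {θ : Fin k → ℝ} (h : IsOrdered μ ε θ)
    {b : Fin k} (hb : 0 < gap μ b) : softmax θ b ≤ 2 * optProb μ θ := by
  have hm := card_optSet_pos μ b
  have h2 : ∀ a ∈ optSet μ, softmax θ b ≤ 2 * softmax θ a := by
    intro a ha
    rw [softmax_eq_exp_sub_mul θ a b]
    refine mul_le_mul_of_nonneg_right ?_ (softmax_nonneg θ a)
    have h3 := (h a b ((mem_optSet μ).1 ha) hb).trans hε
    -- The factor 2 comes from `exp (1/2) ≤ 1 + 1/2 + 1/4 < 2`.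
    have h4 := exp_le_one_add_add_sq (z := 1 / 2) (by rw [abs_of_pos] <;> norm_num)
    have := Real.exp_le_exp.2 h3
    linarith
  have := Finset.sum_le_sum h2
  rw [Finset.sum_const, nsmul_eq_mul, ← Finset.mul_sum] at this
  rw [optProb, mul_div_assoc', le_div_iff₀ hm]
  linarith

/-- The probabilities sum to 1, and both the optimal block and each suboptimal action contribute at
most `2 * optProb μ θ` per action. -/
theorem IsOrdered.one_le_mul_optProb {ε : ℝ} (hε : ε ≤ 1 / 2) {θ : Fin k → ℝ}
    (h : IsOrdered μ ε θ) (a₀ : Fin k) : 1 ≤ 2 * k * optProb μ θ := by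
  have hm := card_optSet_pos μ a₀
  have hq := optProb_nonneg μ θ
  have e1 : ∑ a ∈ optSet μ, softmax θ a ≤ ∑ _a ∈ optSet μ, 2 * optProb μ θ := by
    rw [Finset.sum_const, nsmul_eq_mul, optProb]
    rw [show ((optSet μ).card : ℝ) * (2 * ((∑ a ∈ optSet μ, softmax θ a) / (optSet μ).card))
      = 2 * ∑ a ∈ optSet μ, softmax θ a by field_simp]
    linarith [Finset.sum_nonneg fun a (_ : a ∈ optSet μ) => softmax_nonneg θ a]
  have e2 : ∑ a ∈ (optSet μ)ᶜ, softmax θ a ≤ ∑ _a ∈ (optSet μ)ᶜ, 2 * optProb μ θ := by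
    refine Finset.sum_le_sum fun a ha => h.softmax_le hε ?_
    rw [Finset.mem_compl, mem_optSet] at ha
    exact lt_of_le_of_ne (gap_nonneg μ a) (Ne.symm ha)
  have e3 := add_le_add e1 e2
  rw [Finset.sum_add_sum_compl, Finset.sum_add_sum_compl, sum_softmax θ a₀, Finset.sum_const,
    Finset.card_univ, Fintype.card_fin, nsmul_eq_mul] at e3
  linarith

/-- On ordered logits the expected change of `gapMass` is negative. -/
theorem IsOrdered.sum_massDrift_le {ε η : ℝ} (hε : ε ≤ 1 / 2) (hη : 0 ≤ η)
    (hμ : ∀ a, μ a ∈ Set.Icc (0 : ℝ) 1) (hηgap : η * 20 ≤ gapMin μ)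
    {θ : Fin k → ℝ} (h : IsOrdered μ ε θ) :
    ∑ c, softmax θ c * μ c * massDrift μ η c θ
      ≤ -(η / 3 * optProb μ θ * meanGap μ θ * gapMass μ θ) := by
  have hq := optProb_nonneg μ θ
  have hd := meanGap_nonneg μ θ
  have hu : ∀ b, 0 ≤ relWeight μ θ b := fun b => (Real.exp_pos _).le
  -- As `20 η ≤ gapMin μ`, the second order costs a tenth of each negative first-order term, hence
  -- the factors `9 / 10`.
  have step1 : ∑ c, softmax θ c * μ c * massDrift μ η c θ
      ≤ ∑ b, gap μ b * relWeight μ θ b * (η * (softmax θ b * (meanGap μ θ - 9 / 10 * gap μ b)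
          - 9 / 10 * (optProb μ θ * meanGap μ θ))) := by
    simp only [massDrift, Finset.mul_sum]
    rw [Finset.sum_comm]
    refine Finset.sum_le_sum fun b _ => ?_
    have h0 : 0 ≤ gap μ b * relWeight μ θ b := mul_nonneg (gap_nonneg μ b) (hu b)
    rcases (gap_nonneg μ b).eq_or_lt with hb | hb
    · simp [← hb]
    have e1 : ∀ c, softmax θ c * μ c * (gap μ b * relWeight μ θ b *
          (η * massCoef μ θ b c + (η * massCoef μ θ b c) ^ 2))
        ≤ gap μ b * relWeight μ θ b * (η * (softmax θ c * μ c * massCoef μ θ b c)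
          + η ^ 2 * (softmax θ c * massCoef μ θ b c ^ 2)) := by
      intro c
      have h1 : softmax θ c * μ c * massCoef μ θ b c ^ 2 ≤ softmax θ c * massCoef μ θ b c ^ 2 :=
        mul_le_mul_of_nonneg_right
          (mul_le_of_le_one_right (softmax_nonneg θ c) (hμ c).2) (sq_nonneg _)
      have h2 := mul_le_mul_of_nonneg_left (mul_le_mul_of_nonneg_left h1 (sq_nonneg η)) h0
      linarith
    refine (Finset.sum_le_sum fun c _ => e1 c).trans ?_
    rw [← Finset.mul_sum, Finset.sum_add_distrib, ← Finset.mul_sum, ← Finset.mul_sum,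
      sum_softmax_mul_mean_mul_massCoef]
    refine mul_le_mul_of_nonneg_left ?_ h0
    have e2 := mul_le_mul_of_nonneg_left (sum_softmax_mul_massCoef_sq_le μ θ b) hη
    have e3 : η * (1 - ∑ a ∈ optSet μ, softmax θ a) * 20 ≤ meanGap μ θ := by
      refine le_trans ?_ (gapMin_mul_one_sub_le μ θ b)
      have : 0 ≤ 1 - ∑ a ∈ optSet μ, softmax θ a := by
        rw [sub_nonneg, ← sum_softmax θ b]
        exact Finset.sum_le_sum_of_subset_of_nonneg (Finset.subset_univ _)
          fun a _ _ => softmax_nonneg θ a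
      nlinarith
    have e4 := mul_le_mul_of_nonneg_left e3 hq
    have e5 := mul_le_mul_of_nonneg_left (hηgap.trans (gapMin_le_gap μ hb)) (softmax_nonneg θ b)
    rw [sq, mul_assoc η η, ← mul_add]
    refine mul_le_mul_of_nonneg_left ?_ hη
    linarith
  -- The maximum over `x` of `x (d - 9/10 x)` is `5/18 d²`, and `softmax θ b ≤ 2 * optProb μ θ`
  -- doubles it. The bound no longer involves the gap of `b`, so summing the relative weights
  -- recreates `gapMass`.
  have step2 : ∀ b, gap μ b * relWeight μ θ b * (η * (softmax θ b *
      (meanGap μ θ - 9 / 10 * gap μ b) - 9 / 10 * (optProb μ θ * meanGap μ θ)))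
      ≤ η * (5 / 9 * optProb μ θ * meanGap μ θ ^ 2 * relWeight μ θ b
        - 9 / 10 * (optProb μ θ * meanGap μ θ) * (gap μ b * relWeight μ θ b)) := by
    intro b
    have e1 : gap μ b * (softmax θ b * (meanGap μ θ - 9 / 10 * gap μ b))
        ≤ 5 / 9 * optProb μ θ * meanGap μ θ ^ 2 := by
      rcases (gap_nonneg μ b).eq_or_lt with hb | hb
      · rw [← hb, zero_mul]; positivity
      · have h1 : gap μ b * (meanGap μ θ - 9 / 10 * gap μ b) ≤ 5 / 18 * meanGap μ θ ^ 2 := by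
          nlinarith [sq_nonneg (meanGap μ θ - 9 / 5 * gap μ b)]
        have h2 := mul_le_mul_of_nonneg_left h1 (softmax_nonneg θ b)
        have h3 := mul_le_mul_of_nonneg_right (h.softmax_le hε hb)
          (by positivity : 0 ≤ 5 / 18 * meanGap μ θ ^ 2)
        linarith
    have e2 := mul_le_mul_of_nonneg_left e1 (mul_nonneg hη (hu b))
    linarith
  refine step1.trans ((Finset.sum_le_sum fun b _ => step2 b).trans ?_)
  rw [← Finset.mul_sum, Finset.sum_sub_distrib, ← Finset.mul_sum, ← Finset.mul_sum]
  change η * (_ - _ * gapMass μ θ) ≤ _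
  have : 5 / 9 * optProb μ θ * meanGap μ θ ^ 2 * ∑ b, relWeight μ θ b
      = 5 / 9 * optProb μ θ * meanGap μ θ * gapMass μ θ := by
    rw [gapMass_eq μ θ]; ring
  rw [this]
  -- The remaining coefficient is `5/9 - 9/10 = -31/90`, below `-1/3`.
  have h5 : 0 ≤ η * (optProb μ θ * meanGap μ θ * gapMass μ θ) :=
    mul_nonneg hη (mul_nonneg (mul_nonneg hq hd) (gapMass_nonneg μ θ))
  linarith

/-! ### Drift of the regularised logarithm -/

variable (μ)

/-- The regularised logarithm of `gapMass`. -/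
def logMass (δ : ℝ) (θ : Fin k → ℝ) : ℝ := Real.log (gapMass μ θ + δ)

open Classical in
/-- The coefficient of the reward in the bound on the change of `logMass`. -/
def logMassCoef (δ ε η : ℝ) (c : Fin k) (θ : Fin k → ℝ) : ℝ :=
  if IsOrdered μ ε θ then massDrift μ η c θ / (gapMass μ θ + δ) else 0

open Classical in
-- On ordered logits, concavity of the logarithm transfers the drift of `gapMass`; otherwise only
-- the crude growth factor `exp (2 η)` is used.
theorem logMass_gradStep_le {δ ε η : ℝ} (hδ : 0 < δ) (hη : 0 ≤ η) (hη1 : η ≤ 1 / 2)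
    (θ : Fin k → ℝ) (c : Fin k) {y : ℝ} (hy : y ∈ Set.Icc (0 : ℝ) 1) :
    logMass μ δ (gradStep η θ c y) ≤ logMass μ δ θ + (if IsOrdered μ ε θ then 0 else 2 * η)
      + y * logMassCoef μ δ ε η c θ := by
  have h0 : 0 < gapMass μ θ + δ := by linarith [gapMass_nonneg μ θ]
  have h1 : 0 < gapMass μ (gradStep η θ c y) + δ := by
    linarith [gapMass_nonneg μ (gradStep η θ c y)]
  by_cases h : IsOrdered μ ε θ
  · rw [logMassCoef, if_pos h, if_pos h, logMass, logMass]
    have e1 := Real.log_le_sub_one_of_pos (div_pos h1 h0)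
    rw [Real.log_div h1.ne' h0.ne', div_sub_one h0.ne'] at e1
    have e2 := div_le_div_of_nonneg_right
      (by linarith [gapMass_gradStep_le μ hη hη1 θ c hy] :
        gapMass μ (gradStep η θ c y) + δ - (gapMass μ θ + δ) ≤ y * massDrift μ η c θ) h0.le
    rw [mul_div_assoc] at e2
    linarith
  · rw [logMassCoef, if_neg h, if_neg h, logMass, logMass, mul_zero, add_zero,
      ← Real.log_exp (2 * η), ← Real.log_mul h0.ne' (Real.exp_pos _).ne']
    refine Real.log_le_log h1 ?_
    have e1 := gapMass_gradStep_le_exp μ hη θ c hy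
    have e2 : δ ≤ δ * Real.exp (2 * η) :=
      le_mul_of_one_le_right hδ.le (Real.one_le_exp (by linarith))
    linarith

theorem abs_logMassCoef_le {δ ε η : ℝ} (hδ : 0 < δ) (hη : 0 ≤ η) (hη1 : η ≤ 1 / 2)
    (c : Fin k) (θ : Fin k → ℝ) : |logMassCoef μ δ ε η c θ| ≤ 2 := by
  have h0 : 0 < gapMass μ θ + δ := by linarith [gapMass_nonneg μ θ]
  rw [logMassCoef]
  split_ifs
  · rw [abs_div, abs_of_pos h0, div_le_iff₀ h0]
    linarith [abs_massDrift_le μ hη hη1 c θ]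
  · simp

open Classical in
theorem sum_logMassCoef_le {δ ε η : ℝ} (hδ : 0 < δ) (hε : ε ≤ 1 / 2) (hη : 0 ≤ η)
    (hμ : ∀ a, μ a ∈ Set.Icc (0 : ℝ) 1) (hηgap : η * 20 ≤ gapMin μ)
    (θ : Fin k → ℝ) (a₀ : Fin k) :
    (if IsOrdered μ ε θ then 0 else 2 * η) + ∑ c, softmax θ c * μ c * logMassCoef μ δ ε η c θ
      ≤ -(η / (6 * k) * (meanGap μ θ - δ)) + 3 * η * (if IsOrdered μ ε θ then 0 else 1) := by
  have hk : (1 : ℝ) ≤ k := by exact_mod_cast Fin.pos a₀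
  have hd := meanGap_nonneg μ θ
  have hkη : η / (6 * k) ≤ η := div_le_self hη (by linarith)
  have hkη0 : 0 ≤ η / (6 * k) := div_nonneg hη (by linarith)
  by_cases h : IsOrdered μ ε θ
  · simp only [logMassCoef, if_pos h, mul_zero, add_zero, zero_add, mul_div_assoc']
    rw [← Finset.sum_div]
    have hD := gapMass_nonneg μ θ
    have h0 : 0 < gapMass μ θ + δ := by linarith
    rw [div_le_iff₀ h0]
    refine (h.sum_massDrift_le hε hη hμ hηgap).trans ?_
    rw [neg_mul, neg_le_neg_iff]
    have hq := h.one_le_mul_optProb hε a₀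
    have e1 : η / (6 * k) ≤ η / 3 * optProb μ θ := by
      rw [div_le_iff₀ (by linarith)]
      nlinarith
    have e2 : (meanGap μ θ - δ) * (gapMass μ θ + δ) ≤ meanGap μ θ * gapMass μ θ := by
      nlinarith [meanGap_le_gapMass μ θ a₀]
    have e3 := mul_le_mul_of_nonneg_left e2 hkη0
    -- Regularisation costs only `δ` in the mean gap, because `meanGap ≤ gapMass` (used in `e2`).
    have e4 := mul_le_mul_of_nonneg_right e1 (mul_nonneg hd hD)
    linarith
  · simp only [logMassCoef, if_neg h, mul_zero, Finset.sum_const_zero, add_zero, mul_one]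
    have hd1 := (meanGap_le_gapMax μ θ a₀).trans (gapMax_le_one μ hμ a₀)
    have := mul_le_mul hkη hd1 hd hη
    have := mul_nonneg hkη0 hδ.le
    linarith

end Mass

/-! ### Measurability, integrability and conditioning along a run -/

section Run

variable {n : ℕ} {Ω : Type*} {μ : Fin k → ℝ} {η : ℝ} {A : ℕ → Ω → Fin k} {Y : ℕ → Ω → ℝ}

theorem logits_succ (t : ℕ) (ω : Ω) :
    logits η A Y (t + 1) ω = gradStep η (logits η A Y t ω) (A t ω) (Y t ω) := rfl

theorem history_mono {s t : ℕ} (hst : s ≤ t) : history A Y s ≤ history A Y t :=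
  iSup_le fun r => iSup_le fun hr =>
    le_iSup_of_le r (le_iSup_of_le (hr.trans_le hst) le_rfl)

theorem comap_le_history_succ (t : ℕ) :
    MeasurableSpace.comap (A t) inferInstance ⊔ MeasurableSpace.comap (Y t) inferInstance
      ≤ history A Y (t + 1) :=
  le_iSup_of_le t (le_iSup_of_le (Nat.lt_succ_self t) le_rfl)

theorem measurable_logits (t : ℕ) : Measurable[history A Y t] (logits η A Y t) := by
  induction t with
  | zero => exact measurable_const
  | succ t ih =>
    have h1 : Measurable[history A Y (t + 1)] (logits η A Y t) :=
      ih.mono (history_mono t.le_succ) le_rfl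
    have hA : Measurable[history A Y (t + 1)] (A t) :=
      Measurable.of_comap_le (le_sup_left.trans (comap_le_history_succ t))
    have hY : Measurable[history A Y (t + 1)] (Y t) :=
      Measurable.of_comap_le (le_sup_right.trans (comap_le_history_succ t))
    refine @measurable_pi_lambda _ _ _ (history A Y (t + 1)) _ _ fun a => ?_
    have hs : Measurable[history A Y (t + 1)] fun ω => softmax (logits η A Y t ω) a :=
      (continuous_softmax a).measurable.comp h1
    have hi : Measurable[history A Y (t + 1)] fun ω => if A t ω = a then (1 : ℝ) else 0 :=
      (measurable_of_finite fun b : Fin k => if b = a then (1 : ℝ) else 0).comp hA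
    have hθ : Measurable[history A Y (t + 1)] fun ω => logits η A Y t ω a :=
      (measurable_pi_apply a).comp h1
    exact hθ.add (((hi.sub hs).const_mul η).mul hY)

variable [mΩ : MeasurableSpace Ω] {P : Measure Ω}

namespace IsPolicyGradientRun

theorem history_le (h : IsPolicyGradientRun P μ η n A Y) {t : ℕ} (ht : t ≤ n) :
    history A Y t ≤ mΩ :=
  iSup_le fun s => iSup_le fun hs => sup_le
    (h.measurable_action s (hs.trans_le ht)).comap_le
    (h.measurable_reward s (hs.trans_le ht)).comap_le

theorem measurable_logits (h : IsPolicyGradientRun P μ η n A Y) {t : ℕ} (ht : t ≤ n) :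
    Measurable (logits η A Y t) :=
  (Bandit.measurable_logits t).mono (h.history_le ht) le_rfl

theorem measurable_indicator (h : IsPolicyGradientRun P μ η n A Y) {t : ℕ} (ht : t < n)
    (c : Fin k) : Measurable fun ω => if A t ω = c then (1 : ℝ) else 0 :=
  (measurable_of_finite fun b : Fin k => if b = c then (1 : ℝ) else 0).comp
    (h.measurable_action t ht)

theorem abs_logits_le (h : IsPolicyGradientRun P μ η n A Y) (hη : 0 ≤ η) {t : ℕ} (ht : t ≤ n) :
    ∀ᵐ ω ∂P, ∀ a, |logits η A Y t ω a| ≤ t * η := by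
  induction t with
  | zero => exact Filter.Eventually.of_forall fun ω a => by simp [logits]
  | succ t ih =>
    filter_upwards [ih (by omega), h.reward_mem t (by omega)] with ω h1 h2 a
    rw [logits_succ, gradStep]
    refine (abs_add_le _ _).trans ?_
    have : |η * ((if A t ω = a then 1 else 0) - softmax (logits η A Y t ω) a) * Y t ω| ≤ η := by
      rw [abs_mul, abs_mul, abs_of_nonneg hη, abs_of_nonneg h2.1, mul_assoc]
      exact mul_le_of_le_one_right hη
        (mul_le_one₀ (abs_centred_le_one _ _ _) h2.1 h2.2)
    push_cast
    linarith [h1 a]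

theorem integrable_comp_logits [IsFiniteMeasure P] (h : IsPolicyGradientRun P μ η n A Y)
    (hη : 0 ≤ η) {t : ℕ} (ht : t ≤ n) {F : (Fin k → ℝ) → ℝ} (hF : Continuous F) :
    Integrable (fun ω => F (logits η A Y t ω)) P := by
  obtain ⟨C, hC⟩ := (isCompact_closedBall (0 : Fin k → ℝ) (t * η)).exists_bound_of_continuousOn
    hF.continuousOn
  refine Integrable.of_bound
    (hF.measurable.comp (h.measurable_logits ht)).aestronglyMeasurable C ?_
  filter_upwards [h.abs_logits_le hη ht] with ω hω
  refine hC _ ?_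
  rw [mem_closedBall_zero_iff, pi_norm_le_iff_of_nonneg (by positivity)]
  exact hω

theorem integral_mul_action [IsFiniteMeasure P] (h : IsPolicyGradientRun P μ η n A Y) {t : ℕ}
    (ht : t < n) (c : Fin k) {X : Ω → ℝ} (hX : Measurable[history A Y t] X) {B : ℝ}
    (hB : ∀ ω, |X ω| ≤ B) :
    ∫ ω, X ω * (if A t ω = c then 1 else 0) ∂P
      = ∫ ω, X ω * softmax (logits η A Y t ω) c ∂P := by
  have hm := h.history_le ht.le
  have hI : Integrable (fun ω => if A t ω = c then (1 : ℝ) else 0) P :=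
    Integrable.of_bound (h.measurable_indicator ht c).aestronglyMeasurable 1
      (Filter.Eventually.of_forall fun ω => by split_ifs <;> simp)
  have hXI : Integrable (X * fun ω => if A t ω = c then (1 : ℝ) else 0) P :=
    hI.bdd_mul (hX.mono hm le_rfl).aestronglyMeasurable
      (Filter.Eventually.of_forall fun ω => hB ω)
  have key := condExp_mul_of_stronglyMeasurable_left hX.stronglyMeasurable hXI hI
  rw [show (fun ω => X ω * (if A t ω = c then (1 : ℝ) else 0))
    = X * fun ω => if A t ω = c then (1 : ℝ) else 0 from rfl, ← integral_condExp hm]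
  refine integral_congr_ae ?_
  filter_upwards [key, h.action_law t ht c] with ω h1 h2
  rw [h1, Pi.mul_apply, h2]

/-- Conditioning on past and action replaces the reward by its mean; conditioning on the past alone
then replaces the indicator by its probability. -/
theorem integral_mul_action_mul_reward [IsFiniteMeasure P] (h : IsPolicyGradientRun P μ η n A Y)
    {t : ℕ} (ht : t < n) (c : Fin k) {X : Ω → ℝ} (hX : Measurable[history A Y t] X) {B : ℝ}
    (hB : ∀ ω, |X ω| ≤ B) :
    ∫ ω, X ω * (if A t ω = c then 1 else 0) * Y t ω ∂P
      = ∫ ω, X ω * (softmax (logits η A Y t ω) c * μ c) ∂P := by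
  have hm : history A Y t ⊔ MeasurableSpace.comap (A t) inferInstance ≤ mΩ := sup_le (h.history_le ht.le) (h.measurable_action t ht).comap_le
  have hA : Measurable[history A Y t ⊔ MeasurableSpace.comap (A t) inferInstance] (A t) := Measurable.of_comap_le le_sup_right
  have hi : Measurable[history A Y t ⊔ MeasurableSpace.comap (A t) inferInstance] fun ω => if A t ω = c then (1 : ℝ) else 0 :=
    (measurable_of_finite fun b : Fin k => if b = c then (1 : ℝ) else 0).comp hA
  have hZ : Measurable[history A Y t ⊔ MeasurableSpace.comap (A t) inferInstance] (fun ω => X ω * (if A t ω = c then (1 : ℝ) else 0)) :=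
    (hX.mono le_sup_left le_rfl).mul hi
  have hYI : Integrable (Y t) P := by
    refine Integrable.of_bound (h.measurable_reward t ht).aestronglyMeasurable 1 ?_
    filter_upwards [h.reward_mem t ht] with ω hω
    rw [Real.norm_eq_abs, abs_le]
    exact ⟨by linarith [hω.1], hω.2⟩
  have hZB : ∀ ω, ‖X ω * (if A t ω = c then (1 : ℝ) else 0)‖ ≤ B := by
    intro ω
    have := hB ω
    have h0 := (abs_nonneg _).trans this
    rw [Real.norm_eq_abs]
    split_ifs <;> simpa
  have hZI : Integrable ((fun ω => X ω * (if A t ω = c then (1 : ℝ) else 0)) * Y t) P :=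
    hYI.bdd_mul (hZ.mono hm le_rfl).aestronglyMeasurable (Filter.Eventually.of_forall hZB)
  have key := condExp_mul_of_stronglyMeasurable_left hZ.stronglyMeasurable hZI hYI
  rw [show (fun ω => X ω * (if A t ω = c then (1 : ℝ) else 0) * Y t ω)
    = (fun ω => X ω * (if A t ω = c then (1 : ℝ) else 0)) * Y t from rfl, ← integral_condExp hm]
  have e1 : ∫ ω, (P[(fun ω => X ω * (if A t ω = c then (1 : ℝ) else 0)) * Y t |
        history A Y t ⊔ MeasurableSpace.comap (A t) inferInstance]) ω ∂P
      = ∫ ω, X ω * (if A t ω = c then 1 else 0) * μ c ∂P := by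
    refine integral_congr_ae ?_
    filter_upwards [key, h.reward_mean t ht] with ω h1 h2
    rw [h1, Pi.mul_apply, h2]
    split_ifs with hc
    · rw [hc]
    · simp
  rw [e1, integral_mul_const, h.integral_mul_action ht c hX hB, ← integral_mul_const]
  simp only [mul_assoc]

/-- If a function of the logits changes in one step by at most an amount that is affine in the
reward, then its expectation changes by at most the expectation of the conditional mean of that
amount. -/
theorem integral_succ_le [IsFiniteMeasure P] (h : IsPolicyGradientRun P μ η n A Y) (hη : 0 ≤ η)
    {t : ℕ} (ht : t < n) {F R : (Fin k → ℝ) → ℝ} {ξ : Fin k → (Fin k → ℝ) → ℝ} {B : ℝ}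
    (hF : Continuous F) (hR : Measurable R) (hξ : ∀ c, Measurable (ξ c))
    (hRB : ∀ θ, |R θ| ≤ B) (hξB : ∀ c θ, |ξ c θ| ≤ B)
    (hstep : ∀ θ c, ∀ y ∈ Set.Icc (0 : ℝ) 1, F (gradStep η θ c y) ≤ F θ + R θ + y * ξ c θ)
    {G : (Fin k → ℝ) → ℝ} (hGI : Integrable (fun ω => G (logits η A Y t ω)) P)
    (hG : ∀ θ, R θ + ∑ c, softmax θ c * μ c * ξ c θ ≤ G θ) :
    ∫ ω, F (logits η A Y (t + 1) ω) ∂P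
      ≤ ∫ ω, F (logits η A Y t ω) ∂P + ∫ ω, G (logits η A Y t ω) ∂P := by
  have hθ := h.measurable_logits ht.le
  have hθ' := Bandit.measurable_logits (η := η) (A := A) (Y := Y) t
  have hFI := h.integrable_comp_logits hη ht.le hF
  have hRI : Integrable (fun ω => R (logits η A Y t ω)) P :=
    Integrable.of_bound (hR.comp hθ).aestronglyMeasurable B
      (Filter.Eventually.of_forall fun ω => hRB _)
  have hFR : Integrable (fun ω => F (logits η A Y t ω) + R (logits η A Y t ω)) P := hFI.add hRI
  have hI1 : ∀ c, Integrable
      (fun ω => ξ c (logits η A Y t ω) * (if A t ω = c then 1 else 0) * Y t ω) P := by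
    intro c
    refine Integrable.of_bound ((((hξ c).comp hθ).mul (h.measurable_indicator ht c)).mul
      (h.measurable_reward t ht)).aestronglyMeasurable B ?_
    filter_upwards [h.reward_mem t ht] with ω hω
    rw [Real.norm_eq_abs, abs_mul, abs_mul, abs_of_nonneg hω.1, mul_assoc]
    refine (mul_le_of_le_one_right (abs_nonneg _) (mul_le_one₀ ?_ hω.1 hω.2)).trans (hξB c _)
    split_ifs <;> simp
  have hI2 : ∀ c, Integrable
      (fun ω => ξ c (logits η A Y t ω) * (softmax (logits η A Y t ω) c * μ c)) P := by
    intro c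
    refine Integrable.bdd_mul (c := B) ?_ ((hξ c).comp hθ).aestronglyMeasurable
      (Filter.Eventually.of_forall fun ω => hξB c _)
    exact (h.integrable_comp_logits hη ht.le (continuous_softmax c)).mul_const (μ c)
  calc ∫ ω, F (logits η A Y (t + 1) ω) ∂P
      ≤ ∫ ω, (F (logits η A Y t ω) + R (logits η A Y t ω)
          + ∑ c, ξ c (logits η A Y t ω) * (if A t ω = c then 1 else 0) * Y t ω) ∂P := by
        refine integral_mono_ae (h.integrable_comp_logits hη ht hF)
          (hFR.add (integrable_finsetSum _ fun c _ => hI1 c)) ?_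
        filter_upwards [h.reward_mem t ht] with ω hω
        have := hstep (logits η A Y t ω) (A t ω) (Y t ω) hω
        rw [← logits_succ] at this
        refine this.trans (le_of_eq ?_)
        simp [mul_comm]
    _ = ∫ ω, (F (logits η A Y t ω) + R (logits η A Y t ω)
          + ∑ c, ξ c (logits η A Y t ω) * (softmax (logits η A Y t ω) c * μ c)) ∂P := by
        rw [integral_add hFR (integrable_finsetSum _ fun c _ => hI1 c),
          integral_add hFR (integrable_finsetSum _ fun c _ => hI2 c),
          integral_finsetSum _ fun c _ => hI1 c, integral_finsetSum _ fun c _ => hI2 c]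
        congr 1
        exact Finset.sum_congr rfl fun c _ =>
          h.integral_mul_action_mul_reward ht c ((hξ c).comp hθ') fun ω => hξB c _
    _ ≤ ∫ ω, (F (logits η A Y t ω) + G (logits η A Y t ω)) ∂P := by
        refine integral_mono (hFR.add (integrable_finsetSum _ fun c _ => hI2 c))
          (hFI.add hGI) fun ω => ?_
        have := hG (logits η A Y t ω)
        have e : ∑ c, ξ c (logits η A Y t ω) * (softmax (logits η A Y t ω) c * μ c)
            = ∑ c, softmax (logits η A Y t ω) c * μ c * ξ c (logits η A Y t ω) :=
          Finset.sum_congr rfl fun c _ => mul_comm _ _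
        simp only [e]
        linarith
    _ = _ := integral_add hFI hGI

/-- The expected regret is the sum of the expected mean gaps. -/
theorem integral_regret [IsFiniteMeasure P] (h : IsPolicyGradientRun P μ η n A Y) (hη : 0 ≤ η) :
    ∫ ω, regret μ n A ω ∂P
      = ∑ t ∈ Finset.range n, ∫ ω, meanGap μ (logits η A Y t ω) ∂P := by
  unfold regret
  have hI : ∀ t ∈ Finset.range n, ∀ c, Integrable
      (fun ω => gap μ c * (if A t ω = c then (1 : ℝ) else 0)) P := fun t ht c =>
    (Integrable.of_bound
      (h.measurable_indicator (Finset.mem_range.1 ht) c).aestronglyMeasurable 1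
      (Filter.Eventually.of_forall fun ω => by split_ifs <;> simp)).const_mul _
  have e : ∀ t ω, gap μ (A t ω) = ∑ c, gap μ c * (if A t ω = c then (1 : ℝ) else 0) := by
    intro t ω; simp
  simp_rw [e]
  rw [integral_finsetSum _ fun t ht => integrable_finsetSum _ fun c _ => hI t ht c]
  refine Finset.sum_congr rfl fun t ht => ?_
  have ht' := Finset.mem_range.1 ht
  rw [integral_finsetSum _ fun c _ => hI t ht c]
  unfold meanGap
  rw [integral_finsetSum _ fun c _ =>
    (h.integrable_comp_logits hη ht'.le (continuous_softmax c)).mul_const _]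
  refine Finset.sum_congr rfl fun c _ => ?_
  rw [h.integral_mul_action ht' c (X := fun _ => gap μ c) measurable_const
    (B := |gap μ c|) fun _ => le_rfl]
  simp only [mul_comm]

end IsPolicyGradientRun

end Run

/-! ### Expected potentials and the regret bound -/

section Regret

variable {n : ℕ} {Ω : Type*} {μ : Fin k → ℝ} {η l ε δ : ℝ}
  {A : ℕ → Ω → Fin k} {Y : ℕ → Ω → ℝ}

theorem measurable_pairPotentialCoef (a b c : Fin k) :
    Measurable (pairPotentialCoef η l ε a b c) := by
  have h1 : Continuous fun θ : Fin k → ℝ => pairCoef θ a b c :=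
    (continuous_const.sub (continuous_softmax b)).sub
      (continuous_const.sub (continuous_softmax a))
  unfold pairPotentialCoef
  refine Measurable.ite ?_ (Continuous.measurable (by fun_prop)) measurable_const
  have h2 : Measurable fun θ : Fin k → ℝ => θ b - θ a := by fun_prop
  exact (measurableSet_le measurable_const h2).inter (measurableSet_le h2 measurable_const)

theorem continuous_pairPotential (a b : Fin k) : Continuous (pairPotential l ε a b) := by
  unfold pairPotential
  fun_prop

theorem abs_pairPotentialCoef_le (hl : 0 ≤ l) (hη : 0 ≤ η) (hlη : l * η ≤ 1 / 2)
    (a b c : Fin k) (θ : Fin k → ℝ) :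
    |pairPotentialCoef η l ε a b c θ| ≤ 2 * Real.exp (l * ε) := by
  unfold pairPotentialCoef
  split_ifs with h
  · have hz : |l * η * pairCoef θ a b c| ≤ 1 := by
      rw [abs_mul, abs_of_nonneg (mul_nonneg hl hη)]
      nlinarith [abs_pairCoef_le θ a b c, abs_nonneg (pairCoef θ a b c)]
    have h1 : |l * η * pairCoef θ a b c + (l * η * pairCoef θ a b c) ^ 2| ≤ 2 := by
      have := abs_le.1 hz
      rw [abs_le]
      constructor <;> nlinarith [this.1, this.2]
    rw [abs_mul, abs_of_pos (Real.exp_pos _), mul_comm]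
    exact mul_le_mul h1 (Real.exp_le_exp.2 (mul_le_mul_of_nonneg_left h.2 hl))
      (Real.exp_pos _).le (by norm_num)
  · rw [abs_zero]; positivity

open Classical in
-- Markov's inequality and the union bound in pointwise form: a violating pair has its potential at
-- the cap `exp (l ε)`.
theorem not_isOrdered_le_sum (hl : 0 ≤ l) (θ : Fin k → ℝ) :
    (if IsOrdered μ ε θ then (0 : ℝ) else 1) ≤ ∑ a, ∑ b,
      if gap μ a = 0 ∧ 0 < gap μ b then
        Real.exp (-(l * ε)) * pairPotential l ε a b θ else 0 := by
  have hp : ∀ a b, 0 ≤ Real.exp (-(l * ε)) * pairPotential l ε a b θ := fun a b =>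
    mul_nonneg (Real.exp_pos _).le
      (le_min (le_max_of_le_right zero_le_one) (Real.exp_pos _).le)
  have hnn : ∀ a b, 0 ≤ if gap μ a = 0 ∧ 0 < gap μ b then
      Real.exp (-(l * ε)) * pairPotential l ε a b θ else 0 := by
    intro a b
    split_ifs
    exacts [hp a b, le_rfl]
  split_ifs with h
  · exact Finset.sum_nonneg fun a _ => Finset.sum_nonneg fun b _ => hnn a b
  · simp only [IsOrdered, not_forall, not_le] at h
    obtain ⟨a, b, ha, hb, hab⟩ := h
    refine le_trans ?_ ((Finset.single_le_sum (fun b _ => hnn a b) (Finset.mem_univ b)).trans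
      (Finset.single_le_sum (f := fun a => ∑ b, if gap μ a = 0 ∧ 0 < gap μ b then
        Real.exp (-(l * ε)) * pairPotential l ε a b θ else 0)
        (fun a _ => Finset.sum_nonneg fun b _ => hnn a b) (Finset.mem_univ a)))
    rw [if_pos ⟨ha, hb⟩]
    have h2 : Real.exp (l * ε) ≤ pairPotential l ε a b θ :=
      le_min (le_max_of_le_left (Real.exp_le_exp.2 (mul_le_mul_of_nonneg_left hab.le hl))) le_rfl
    calc (1 : ℝ) = Real.exp (-(l * ε)) * Real.exp (l * ε) := by
          rw [← Real.exp_add, neg_add_cancel, Real.exp_zero]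
      _ ≤ _ := mul_le_mul_of_nonneg_left h2 (Real.exp_pos _).le

theorem measurable_logMassCoef (hδ : 0 < δ) (c : Fin k) :
    Measurable (logMassCoef μ δ ε η c) := by
  unfold logMassCoef massDrift relWeight massCoef optMean
  have hs : ∀ a : Fin k, Continuous fun θ : Fin k → ℝ => softmax θ a := continuous_softmax
  refine Measurable.ite (measurableSet_isOrdered μ ε) (Continuous.measurable ?_) measurable_const
  refine Continuous.div (by fun_prop) ((continuous_gapMass μ).add continuous_const) fun θ => ?_
  linarith [gapMass_nonneg μ θ]

theorem continuous_logMass (hδ : 0 < δ) : Continuous (logMass μ δ) := by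
  unfold logMass
  exact ((continuous_gapMass μ).add continuous_const).log fun θ =>
    (add_pos_of_nonneg_of_pos (gapMass_nonneg μ θ) hδ).ne'

theorem log_le_logMass (hδ : 0 < δ) (θ : Fin k → ℝ) : Real.log δ ≤ logMass μ δ θ :=
  Real.log_le_log hδ (by linarith [gapMass_nonneg μ θ])

theorem logMass_zero_le (hδ : 0 < δ) (hδ1 : δ ≤ 1) (hμ : ∀ a, μ a ∈ Set.Icc (0 : ℝ) 1) :
    logMass μ δ (0 : Fin k → ℝ) ≤ Real.log (k + 1) := by
  refine Real.log_le_log (by linarith [gapMass_nonneg μ (0 : Fin k → ℝ)]) ?_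
  have : gapMass μ (0 : Fin k → ℝ) ≤ ∑ _b : Fin k, (1 : ℝ) := by
    refine Finset.sum_le_sum fun b _ => ?_
    have : relWeight μ (0 : Fin k → ℝ) b = 1 := by simp [relWeight, optMean]
    rw [this, mul_one]
    exact gap_le_one μ hμ b
  simp at this
  linarith

/-- Elementary consequences of the learning rate condition. -/
theorem two_le_and_mul_le_gapMin (hgap : ∃ a, 0 < gap μ a) (hkn : k ≤ n) (hη : 0 < η)
    (hηle : η ≤ gapMin μ ^ 2 / (120 * gapMax μ * Real.log (n * k))) :
    2 ≤ k ∧ η * 120 ≤ gapMin μ := by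
  obtain ⟨b, hb⟩ := hgap
  obtain ⟨a, ha⟩ := exists_gap_eq_zero μ b
  have hmin := gapMin_pos μ ⟨b, hb⟩
  have hminb := gapMin_le_gap μ hb
  have hmaxb := gap_le_gapMax μ b
  have hmax : 0 < gapMax μ := hb.trans_le hmaxb
  have hk2 : 2 ≤ k := by
    have hab : a.1 ≠ b.1 := fun hab => by rw [Fin.ext hab] at ha; linarith
    have := a.2
    have := b.2
    omega
  have hk : (2 : ℝ) ≤ k := by exact_mod_cast hk2
  have hkn' : (k : ℝ) ≤ n := by exact_mod_cast hkn
  -- `n k ≥ 4 > e` makes the logarithm at least 1, so it can be dropped from the learning rate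
  -- condition.
  have hnk : (4 : ℝ) ≤ n * k := by nlinarith
  have hlog1 : 1 ≤ Real.log (n * k) := by
    rw [Real.le_log_iff_exp_le (by linarith)]
    linarith [Real.exp_one_lt_d9]
  have hη' : η * (120 * gapMax μ * Real.log (n * k)) ≤ gapMin μ ^ 2 :=
    (le_div_iff₀ (by positivity)).1 hηle
  refine ⟨hk2, ?_⟩
  have h1 : η * 120 * gapMax μ ≤ gapMin μ ^ 2 := by
    refine le_trans ?_ hη'
    have : 0 ≤ η * 120 * gapMax μ := by positivity
    nlinarith
  have h2 : gapMin μ ^ 2 ≤ gapMin μ * gapMax μ := by nlinarith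
  exact le_of_mul_le_mul_right (h1.trans h2) hmax

variable [mΩ : MeasurableSpace Ω] {P : Measure Ω} [IsProbabilityMeasure P]

namespace IsPolicyGradientRun

theorem integral_pairPotential_le (h : IsPolicyGradientRun P μ η n A Y)
    (hμ : ∀ a, μ a ∈ Set.Icc (0 : ℝ) 1) (hη : 0 ≤ η) (hl : 0 ≤ l) (hε : 0 ≤ ε)
    (hlη : l * η ≤ 1 / 2) {a b : Fin k} (ha : gap μ a = 0) (hb : 0 < gap μ b)
    (hεb : ε * gapMax μ + 2 * (l * η) ≤ gap μ b) {t : ℕ} (ht : t ≤ n) :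
    ∫ ω, pairPotential l ε a b (logits η A Y t ω) ∂P ≤ 1 + 2 * t := by
  induction t with
  | zero =>
    have : ∀ ω, pairPotential l ε a b (logits η A Y 0 ω) ≤ 1 := fun ω =>
      (min_le_left _ _).trans (by simp [logits])
    have h1 := integral_mono (μ := P)
      (h.integrable_comp_logits hη ht (continuous_pairPotential a b))
      (integrable_const 1) this
    simpa using h1
  | succ t ih =>
    have hone : 1 ≤ Real.exp (l * ε) := Real.one_le_exp (mul_nonneg hl hε)
    have := h.integral_succ_le hη (t := t) (by omega) (F := pairPotential l ε a b)
      (R := fun _ => 2) (ξ := pairPotentialCoef η l ε a b) (B := 2 * Real.exp (l * ε))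
      (continuous_pairPotential a b) measurable_const (measurable_pairPotentialCoef a b)
      (fun _ => by rw [abs_of_pos] <;> linarith)
      (abs_pairPotentialCoef_le hl hη hlη a b)
      (fun θ c y hy => pairPotential_gradStep_le hl hε hη hlη θ a b c hy)
      (G := fun _ => 2) (integrable_const _)
      (fun θ => by linarith [sum_pairPotentialCoef_nonpos μ hμ hl hη ha hb hεb θ])
    have ih := ih (by omega)
    simp only [integral_const, probReal_univ, one_smul] at this
    push_cast
    linarith

open Classical in
theorem integrable_not_isOrdered (h : IsPolicyGradientRun P μ η n A Y) {t : ℕ} (ht : t ≤ n) :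
    Integrable (fun ω => if IsOrdered μ ε (logits η A Y t ω) then (0 : ℝ) else 1) P := by
  refine Integrable.of_bound (Measurable.aestronglyMeasurable ?_) 1
    (Filter.Eventually.of_forall fun ω => by split_ifs <;> simp)
  exact Measurable.ite (h.measurable_logits ht (measurableSet_isOrdered μ ε))
    measurable_const measurable_const

open Classical in
/-- The logits are ordered with high probability. -/
theorem integral_not_isOrdered_le (h : IsPolicyGradientRun P μ η n A Y)
    (hμ : ∀ a, μ a ∈ Set.Icc (0 : ℝ) 1) (hη : 0 ≤ η) (hl : 0 ≤ l) (hε : 0 ≤ ε)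
    (hlη : l * η ≤ 1 / 2) (hεb : ε * gapMax μ + 2 * (l * η) ≤ gapMin μ) {t : ℕ} (ht : t ≤ n) :
    ∫ ω, (if IsOrdered μ ε (logits η A Y t ω) then (0 : ℝ) else 1) ∂P
      ≤ k ^ 2 * (Real.exp (-(l * ε)) * (1 + 2 * t)) := by
  have hI : ∀ a b : Fin k, Integrable (fun ω => if gap μ a = 0 ∧ 0 < gap μ b then
      Real.exp (-(l * ε)) * pairPotential l ε a b (logits η A Y t ω) else 0) P := by
    intro a b
    split_ifs
    · exact (h.integrable_comp_logits hη ht (continuous_pairPotential a b)).const_mul _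
    · exact integrable_zero _ _ _
  refine (integral_mono (h.integrable_not_isOrdered ht)
    (integrable_finsetSum _ fun a _ => integrable_finsetSum _ fun b _ => hI a b)
    fun ω => not_isOrdered_le_sum hl (logits η A Y t ω)).trans ?_
  rw [integral_finsetSum _ fun a _ => integrable_finsetSum _ fun b _ => hI a b]
  have : ∀ a b : Fin k, ∫ ω, (if gap μ a = 0 ∧ 0 < gap μ b then
      Real.exp (-(l * ε)) * pairPotential l ε a b (logits η A Y t ω) else 0) ∂P
      ≤ Real.exp (-(l * ε)) * (1 + 2 * t) := by
    intro a b
    split_ifs with hab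
    · rw [integral_const_mul]
      exact mul_le_mul_of_nonneg_left (h.integral_pairPotential_le hμ hη hl hε hlη hab.1 hab.2
        (hεb.trans (gapMin_le_gap μ hab.2)) ht) (Real.exp_pos _).le
    · rw [integral_zero]; positivity
  calc _ ≤ ∑ _a : Fin k, ∑ _b : Fin k, Real.exp (-(l * ε)) * (1 + 2 * (t : ℝ)) := by
        refine Finset.sum_le_sum fun a _ => ?_
        rw [integral_finsetSum _ fun b _ => hI a b]
        exact Finset.sum_le_sum fun b _ => this a b
    _ = _ := by simp; ring

open Classical in
-- Telescoped drift inequality: past mean gaps are paid for by the decrease of the potential, up to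
-- the expected number of unordered rounds.
theorem integral_logMass_le (h : IsPolicyGradientRun P μ η n A Y)
    (hμ : ∀ a, μ a ∈ Set.Icc (0 : ℝ) 1) (hη : 0 ≤ η) (hη1 : η ≤ 1 / 2)
    (hηgap : η * 20 ≤ gapMin μ) (hε : ε ≤ 1 / 2) (hδ : 0 < δ) (a₀ : Fin k) {t : ℕ}
    (ht : t ≤ n) :
    ∫ ω, logMass μ δ (logits η A Y t ω) ∂P ≤ logMass μ δ (0 : Fin k → ℝ)
      - η / (6 * k) * ∑ s ∈ Finset.range t, (∫ ω, meanGap μ (logits η A Y s ω) ∂P - δ)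
      + 3 * η * ∑ s ∈ Finset.range t,
        ∫ ω, (if IsOrdered μ ε (logits η A Y s ω) then (0 : ℝ) else 1) ∂P := by
  induction t with
  | zero =>
    have : ∀ ω, logits η A Y 0 ω = 0 := fun ω => rfl
    simp [this]
  | succ t ih =>
    have ht' : t < n := ht
    have hM := h.integrable_comp_logits hη ht'.le (continuous_meanGap μ)
    have hO := h.integrable_not_isOrdered (ε := ε) ht'.le
    have hM' := ((hM.sub (integrable_const δ)).const_mul (η / (6 * k))).neg
    have hG : Integrable (fun ω => -(η / (6 * k) * (meanGap μ (logits η A Y t ω) - δ))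
        + 3 * η * (if IsOrdered μ ε (logits η A Y t ω) then 0 else 1)) P :=
      hM'.add (hO.const_mul (3 * η))
    have := h.integral_succ_le hη ht' (F := logMass μ δ)
      (R := fun θ => if IsOrdered μ ε θ then 0 else 2 * η) (ξ := logMassCoef μ δ ε η) (B := 2)
      (continuous_logMass hδ)
      (Measurable.ite (measurableSet_isOrdered μ ε) measurable_const measurable_const)
      (measurable_logMassCoef hδ)
      (fun θ => by
        split_ifs
        · simp
        · rw [abs_of_nonneg] <;> linarith)
      (abs_logMassCoef_le μ hδ hη hη1)
      (fun θ c y hy => logMass_gradStep_le μ hδ hη hη1 θ c hy)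
      (G := fun θ => -(η / (6 * k) * (meanGap μ θ - δ))
        + 3 * η * (if IsOrdered μ ε θ then 0 else 1))
      hG (fun θ => sum_logMassCoef_le μ hδ hε hη hμ hηgap θ a₀)
    have e : ∫ ω, (-(η / (6 * k) * (meanGap μ (logits η A Y t ω) - δ))
        + 3 * η * (if IsOrdered μ ε (logits η A Y t ω) then 0 else 1)) ∂P
        = -(η / (6 * k) * (∫ ω, meanGap μ (logits η A Y t ω) ∂P - δ))
          + 3 * η * ∫ ω, (if IsOrdered μ ε (logits η A Y t ω) then (0 : ℝ) else 1) ∂P := by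
      refine (integral_add hM' (hO.const_mul (3 * η))).trans ?_
      rw [integral_const_mul]
      congr 1
      refine (integral_neg _).trans ?_
      rw [integral_const_mul]
      congr 2
      refine (integral_sub hM (integrable_const δ)).trans ?_
      simp
    rw [e] at this
    have ih := ih ht'.le
    rw [Finset.sum_range_succ, Finset.sum_range_succ]
    linarith

theorem integral_regret_le (h : IsPolicyGradientRun P μ η n A Y)
    (hμ : ∀ a, μ a ∈ Set.Icc (0 : ℝ) 1) (hgap : ∃ a, 0 < gap μ a) (hkn : k ≤ n) (hη : 0 < η)
    (hηle : η ≤ gapMin μ ^ 2 / (120 * gapMax μ * Real.log (n * k))) :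
    ∫ ω, regret μ n A ω ∂P ≤ 1 + 18 * (k * Real.log n / η) + 54 * k := by
  classical
  obtain ⟨b, hb⟩ := hgap
  have hmin := gapMin_pos μ ⟨b, hb⟩
  have hminb := gapMin_le_gap μ hb
  have hmaxb := gap_le_gapMax μ b
  have hmax : 0 < gapMax μ := hb.trans_le hmaxb
  have hmax1 := gapMax_le_one μ hμ b
  obtain ⟨hk2, hη120⟩ := two_le_and_mul_le_gapMin ⟨b, hb⟩ hkn hη hηle
  have hk : (2 : ℝ) ≤ k := by exact_mod_cast hk2
  have hkn' : (k : ℝ) ≤ n := by exact_mod_cast hkn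
  have hn0 : (0 : ℝ) < n := by linarith
  have hnk : (4 : ℝ) ≤ n * k := by nlinarith
  have hlog0 : 0 < Real.log (n * k) := Real.log_pos (by linarith)
  have hη' : η * (120 * gapMax μ * Real.log (n * k)) ≤ gapMin μ ^ 2 :=
    (le_div_iff₀ (by positivity)).1 hηle
  -- These choices give `ε * gapMax μ = gapMin μ / 2` and `2 * (l * η) = gapMin μ / 2`, exhausting
  -- the available gap. Then `l ε = gapMin² / (8 η gapMax)`, which the learning rate condition makes
  -- at least `15 log (n k)`; twice the logarithm suffices.
  set ε := gapMin μ / (2 * gapMax μ) with hεdef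
  set l := gapMin μ / (4 * η) with hldef
  have hlη : l * η = gapMin μ / 4 := by rw [hldef]; field_simp
  have hεmax : ε * gapMax μ = gapMin μ / 2 := by rw [hεdef]; field_simp
  have hl : 0 ≤ l := by positivity
  have hε0 : 0 ≤ ε := by positivity
  have hε : ε ≤ 1 / 2 := by
    rw [hεdef, div_le_iff₀ (by linarith)]; linarith
  have hlε : 2 * Real.log (n * k) ≤ l * ε := by
    have : l * ε = gapMin μ ^ 2 / (8 * η * gapMax μ) := by
      rw [hldef, hεdef]; field_simp; ring
    rw [this, le_div_iff₀ (by positivity)]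
    have : 0 ≤ η * gapMax μ * Real.log (n * k) := by positivity
    linarith
  have hexp : Real.exp (-(l * ε)) ≤ 1 / (n * k) ^ 2 := by
    rw [Real.exp_neg, ← one_div]
    refine one_div_le_one_div_of_le (by positivity) ?_
    rw [← Real.log_le_iff_le_exp (by positivity), Real.log_pow]
    exact_mod_cast hlε
  have hbad : ∑ t ∈ Finset.range n,
      ∫ ω, (if IsOrdered μ ε (logits η A Y t ω) then (0 : ℝ) else 1) ∂P ≤ 3 := by
    have : ∀ t ∈ Finset.range n,
        ∫ ω, (if IsOrdered μ ε (logits η A Y t ω) then (0 : ℝ) else 1) ∂P ≤ 3 / n := by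
      intro t ht
      have ht' : t < n := Finset.mem_range.1 ht
      have ht1 : (t : ℝ) + 1 ≤ n := by exact_mod_cast ht'
      have ht0 : (0 : ℝ) ≤ t := Nat.cast_nonneg t
      refine (h.integral_not_isOrdered_le hμ hη.le hl hε0 (by linarith)
        (by rw [hεmax, hlη]; linarith) ht'.le).trans ?_
      calc (k : ℝ) ^ 2 * (Real.exp (-(l * ε)) * (1 + 2 * t))
          ≤ (k : ℝ) ^ 2 * (1 / (n * k) ^ 2 * (3 * n)) :=
            mul_le_mul_of_nonneg_left
              (mul_le_mul hexp (by linarith) (by linarith) (by positivity)) (sq_nonneg _)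
        _ = 3 / n := by field_simp
    refine (Finset.sum_le_sum this).trans (le_of_eq ?_)
    rw [Finset.sum_const, Finset.card_range, nsmul_eq_mul]
    field_simp
  -- With `δ = 1/n` the regularisation adds 1 to the regret over `n` rounds, while the potential
  -- stays above `-log n`.
  have hδ : (0 : ℝ) < 1 / n := by positivity
  have hδ1 : (1 : ℝ) / n ≤ 1 := by rw [div_le_one hn0]; linarith
  have hup := h.integral_logMass_le hμ hη.le (by linarith) (by linarith) hε hδ b le_rfl
  have hlow : -Real.log n ≤ ∫ ω, logMass μ (1 / n) (logits η A Y n ω) ∂P := by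
    have := integral_mono (μ := P) (integrable_const (Real.log (1 / n)))
      (h.integrable_comp_logits hη.le le_rfl (continuous_logMass (μ := μ) hδ))
      fun ω => log_le_logMass hδ (logits η A Y n ω)
    simpa [Real.log_inv] using this
  have hinit := logMass_zero_le (k := k) (μ := μ) hδ hδ1 hμ
  -- Since `2 ≤ k ≤ n`, `k + 1 ≤ n²`.
  have hlogk : Real.log (k + 1) ≤ 2 * Real.log n := by
    rw [← Real.log_rpow hn0]
    refine Real.log_le_log (by linarith) ?_
    norm_num
    nlinarith
  rw [Finset.sum_sub_distrib, ← h.integral_regret hη.le] at hup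
  simp only [Finset.sum_const, Finset.card_range, nsmul_eq_mul] at hup
  rw [mul_one_div_cancel hn0.ne'] at hup
  have hbad' := mul_le_mul_of_nonneg_left hbad (by positivity : 0 ≤ 3 * η)
  have hfin : η / (6 * k) * (∫ ω, regret μ n A ω ∂P - 1) ≤ 3 * Real.log n + 9 * η := by
    linarith
  have hX : 0 < 6 * k / η := by positivity
  have := mul_le_mul_of_nonneg_left hfin hX.le
  rw [← mul_assoc, show 6 * (k : ℝ) / η * (η / (6 * k)) = 1 by field_simp, one_mul,
    show 6 * (k : ℝ) / η * (3 * Real.log n + 9 * η) = 18 * (k * Real.log n / η) + 54 * k by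
      field_simp; ring] at this
  linarith

end IsPolicyGradientRun

end Regret

end Bandit

end

theorem theorem1 :
    ∃ C : ℝ, 0 < C ∧
      ∀ (k n : ℕ) (μ : Fin k → ℝ) (η : ℝ) (Ω : Type*) [MeasurableSpace Ω]
        (P : Measure Ω) [IsProbabilityMeasure P]
        (A : ℕ → Ω → Fin k) (Y : ℕ → Ω → ℝ),
        k ≤ n →
        (∀ a, μ a ∈ Set.Icc (0 : ℝ) 1) →
        (∃ a, 0 < Bandit.gap μ a) →
        0 < η →
        η ≤ Bandit.gapMin μ ^ 2 / (120 * Bandit.gapMax μ * Real.log (n * k)) →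
        Bandit.IsPolicyGradientRun P μ η n A Y →
        ∫ ω, Bandit.regret μ n A ω ∂P ≤ C * (k * Real.log n * Real.log k / η) := by
  -- With `X = k log n / η` one has `1 ≤ k ≤ X`, so the regret is at most `73 X`, while `log k ≥
  -- 1/2` makes the target at least `100 X`.
  refine ⟨200, by norm_num, fun k n μ η Ω _ P _ A Y hkn hμ hgap hη hηle h => ?_⟩
  obtain ⟨hk2, hη120⟩ := Bandit.two_le_and_mul_le_gapMin hgap hkn hη hηle
  have hη1 : η * 120 ≤ 1 :=
    hη120.trans ((Bandit.gapMin_le_gap μ hgap.choose_spec).trans (Bandit.gap_le_one μ hμ _))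
  have hk : (2 : ℝ) ≤ k := by exact_mod_cast hk2
  have hkn' : (k : ℝ) ≤ n := by exact_mod_cast hkn
  have hlog2 := Real.log_two_gt_d9
  have hlogk : 1 / 2 ≤ Real.log k := by
    linarith [Real.log_le_log (by norm_num) hk]
  have hlogn : 1 / 2 ≤ Real.log n := by
    linarith [Real.log_le_log (by norm_num) (hk.trans hkn')]
  refine (h.integral_regret_le hμ hgap hkn hη hηle).trans ?_
  set X := (k : ℝ) * Real.log n / η with hX
  have hkX : (k : ℝ) ≤ X := by
    rw [hX, le_div_iff₀ hη]
    nlinarith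
  have e : (k : ℝ) * Real.log n * Real.log k / η = X * Real.log k := by rw [hX]; ring
  rw [e]
  nlinarith
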